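/- There is exactly one infinitely differentiable function $\varphi\colon\mathbb R\to\mathbb R$ such that (a) $\operatorname{supp}(\varphi)=[-1,1]$; (b) $\varphi(t)>0$ for all $t\in(-1,1)$; (c) $\varphi(0)=1$; (d) there is a constant $k>0$ with $\varphi'(t)=k\bigl(\varphi(2t+1)-\varphi(2t-1)\bigr)$ for all $t\in\mathbb R$. This function takes rational values at each dyadic point: $\varphi(q/2^n)\in\mathbb Q$ for all $q\in\mathbb Z$ and all integers $n\ge 0$. More precisely, let $s(h)$ denote the sum of the digits of $h$ written in base $2$. For all integers $n\ge 0$ and $q$ with $|q|<2^n$, \[ \varphi\Bigl(\frac{q}{2^{n}}\Bigr)=2\sum_{h=0}^{q+2^n-1}\ \sum_{k=0}^{\lfloor n/2\rfloor}(-1)^{s(h)}\,\frac{2^{\binom{2k+1}{2}-\binom{n+1}{2}}}{(n-2k)!}\,\bigl(2(q-h)+2^{n+1}-1\bigr)^{n-2k}\,\varphi\bigl(1-2^{-2k-1}\bigr), \] and for all integers $k\ge 0$ \[ \varphi\bigl(1-2^{-2k-1}\bigr)=\frac{c_k}{2\,(2k)!\;2^{\binom{2k+1}{2}}}, \] where the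 rational numbers $c_k$ are defined by $c_0=1$ and the recurrence $(2k+1)\,2^{2k}\,c_k=\sum_{h=0}^{k}\binom{2k+1}{2h}\,c_h$ for $k\ge 1$. -/

import Mathlib

open scoped ContDiff

/-- The defining properties of `φ`: an infinitely differentiable `φ : ℝ → ℝ` with (closed, hence
compact) support `[-1, 1]`, positive on `(-1, 1)`, with `φ 0 = 1`, and such that for some
constant `k > 0` one has `φ' t = k (φ (2 t + 1) - φ (2 t - 1))` for all `t`. -/
structure IsUp (φ : ℝ → ℝ) : Prop where
  smooth : ContDiff ℝ ∞ φ
  support_eq : tsupport φ = Set.Icc (-1) 1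
  pos : ∀ t ∈ Set.Ioo (-1 : ℝ) 1, 0 < φ t
  map_zero : φ 0 = 1
  deriv_eq : ∃ k : ℝ, 0 < k ∧ ∀ t : ℝ, deriv φ t = k * (φ (2 * t + 1) - φ (2 * t - 1))

/-- The rational numbers `c_k` with `c_0 = 1` and
`(2k+1) 2^{2k} c_k = ∑_{h=0}^{k} (2k+1 choose 2h) c_h`, the recurrence being solved for its
last term (see `upCoeff_recurrence`). -/
def upCoeff : ℕ → ℚ
  | 0 => 1
  | k + 1 =>
    (∑ h : Fin (k + 1), ((2 * (k + 1) + 1).choose (2 * (h : ℕ)) : ℚ) * upCoeff h) /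
      ((2 * ((k : ℚ) + 1) + 1) * (2 ^ (2 * (k + 1)) - 1))

theorem upCoeff_zero : upCoeff 0 = 1 := by
  rw [upCoeff]

theorem upCoeff_recurrence (k : ℕ) :
    (2 * (k : ℚ) + 1) * 2 ^ (2 * k) * upCoeff k =
      ∑ h ∈ Finset.range (k + 1), ((2 * k + 1).choose (2 * h) : ℚ) * upCoeff h := by
  cases k with
  | zero => simp
  | succ k =>
    have h1 : (2 * ((k : ℚ) + 1) + 1) ≠ 0 := by positivity
    have h2 : ((2 : ℚ) ^ (2 * (k + 1)) - 1) ≠ 0 := by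
      have : (1 : ℚ) < 2 ^ (2 * (k + 1)) := one_lt_pow₀ (by norm_num) (by omega)
      linarith
    have h3 : (2 * ((k : ℚ) + 1) + 1) * (2 ^ (2 * (k + 1)) - 1) * upCoeff (k + 1) =
        ∑ h ∈ Finset.range (k + 1),
          ((2 * (k + 1) + 1).choose (2 * h) : ℚ) * upCoeff h := by
      rw [upCoeff, mul_div_cancel₀ _ (mul_ne_zero h1 h2), Finset.sum_range]
    rw [Finset.sum_range_succ, ← h3, Nat.choose_succ_self_right]
    push_cast
    ring

/-- The sum of the digits of `h` written in base `2`. -/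
def binaryDigitSum (h : ℕ) : ℕ := (Nat.digits 2 h).sum

/-!
# The up function and its values at dyadic points

Write `window f t = ∫ u in 2t-1..2t+1, f u`. Integrating the functional equation from `-1` shows
that `φ` is a multiple of `window φ`; evaluating at `0` and on `[0, 1]` shows that the multiple is
`1` and that `φ t + φ (t - 1) = 1` there. So the functions in question are exactly the fixed points
of `window` among the nonnegative continuous functions that vanish outside `(-1, 1)` and whose
integer translates sum to `1` (`IsPartitionBump`). On this complete space the square of `window` is
a contraction (`IsPartitionBump.abs_window_window_sub_le`): a difference `d` of two members has zero
integral, so `window d` can be computed by integrating from either end of `[-1, 1]`, which gives a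
bound `4 |t| (1 - |t|) sup |d|`, and integrating this bound over a half of `[-1, 1]` gives `2 / 3`.
Smoothness of the fixed point follows from `φ' t = 2 (φ (2t+1) - φ (2t-1))`, and positivity spreads
from `φ 0 = 1` to `(-1, 1)` through `φ = window φ`. Uniqueness also makes `φ` even.

For the values, let `I n` be the `(n+1)`-fold primitive of `φ` vanishing at `-1`. The functional
equation gives `2 ^ (n+1) * I n x = I (n+1) (2x+1) - I (n+1) (2x-1)`
(`IsUp.iterPrimitive_recurrence`), and iterating it expresses `φ t` as a signed sum of `I n` at the
points `2^(n+1) t + 2^(n+1) - 1 - 2h`, the sign being `(-1) ^ s(h)`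
(`IsUp.eq_sum_iterPrimitive`). At `t = q / 2^n` these points are odd integers, so none lies strictly
inside `[-1, 1]`: below, `I n` vanishes, and above, it is a polynomial whose coefficients are the
moments of `φ`. The odd moments vanish by evenness. The even ones satisfy the recurrence of
`upCoeff` (`IsUp.moment_recurrence`), and the single surviving term at `2^(-2k-1) - 1` is a half
moment, which identifies them with the values `φ (1 - 2^(-2k-1))`.
-/

open intervalIntegral Set

/-! ### The averaging operator -/

/-- The averaging operator `f ↦ (t ↦ ∫ u in 2t-1..2t+1, f u)`, whose fixed points are the
integrated form of the equation `φ' t = 2 (φ (2t+1) - φ (2t-1))`. -/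
noncomputable def window (f : ℝ → ℝ) (t : ℝ) : ℝ := ∫ u in (2 * t - 1)..(2 * t + 1), f u

theorem window_eq_sub {f : ℝ → ℝ} (hf : Continuous f) (a t : ℝ) :
    window f t = (∫ u in a..(2 * t + 1), f u) - ∫ u in a..(2 * t - 1), f u :=
  (integral_interval_sub_left (hf.intervalIntegrable _ _) (hf.intervalIntegrable _ _)).symm

theorem hasDerivAt_window {f : ℝ → ℝ} (hf : Continuous f) (t : ℝ) :
    HasDerivAt (window f) (2 * (f (2 * t + 1) - f (2 * t - 1))) t := by
  have hP : ∀ x, HasDerivAt (fun x => ∫ u in (0 : ℝ)..x, f u) (f x) x := fun x =>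
    integral_hasDerivAt_right (hf.intervalIntegrable _ _)
      (hf.stronglyMeasurableAtFilter _ _) hf.continuousAt
  have h1 : HasDerivAt (fun t : ℝ => 2 * t + 1) 2 t := by
    simpa using ((hasDerivAt_id t).const_mul 2).add_const 1
  have h2 : HasDerivAt (fun t : ℝ => 2 * t - 1) 2 t := by
    simpa using ((hasDerivAt_id t).const_mul 2).sub_const 1
  have h3 := ((hP _).comp t h1).sub ((hP _).comp t h2)
  have h4 : window f = ((fun x => ∫ u in (0 : ℝ)..x, f u) ∘ fun t => 2 * t + 1) -
      ((fun x => ∫ u in (0 : ℝ)..x, f u) ∘ fun t => 2 * t - 1) := by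
    funext s
    exact window_eq_sub hf 0 s
  rw [h4]
  exact h3.congr_deriv (by ring)

theorem continuous_window {f : ℝ → ℝ} (hf : Continuous f) : Continuous (window f) :=
  continuous_iff_continuousAt.2 fun t => (hasDerivAt_window hf t).continuousAt

theorem integral_eq_zero_of_vanish {f : ℝ → ℝ} {a b : ℝ} (h : ∀ t ∈ uIoc a b, f t = 0) :
    ∫ u in a..b, f u = 0 :=
  integral_zero_ae (Filter.Eventually.of_forall h)

/-- The endpoints of an integral may be moved across intervals on which the integrand vanishes. -/
theorem integral_eq_of_vanish {f : ℝ → ℝ} (hf : Continuous f) {a b c d : ℝ}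
    (hac : ∀ t ∈ uIoc a c, f t = 0) (hbd : ∀ t ∈ uIoc b d, f t = 0) :
    ∫ u in a..b, f u = ∫ u in c..d, f u := by
  have h1 := integral_add_adjacent_intervals (hf.intervalIntegrable (μ := MeasureTheory.volume) a c)
    (hf.intervalIntegrable c b)
  have h2 := integral_add_adjacent_intervals (hf.intervalIntegrable (μ := MeasureTheory.volume) c b)
    (hf.intervalIntegrable b d)
  rw [integral_eq_zero_of_vanish hac] at h1
  rw [integral_eq_zero_of_vanish hbd] at h2
  linarith

section Vanishing

variable {f : ℝ → ℝ}

theorem integral_eq_of_le_neg_one (hf : Continuous f) (h0 : ∀ t, 1 ≤ |t| → f t = 0)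
    {a b : ℝ} (ha : a ≤ -1) : ∫ u in a..b, f u = ∫ u in (-1)..b, f u := by
  refine integral_eq_of_vanish hf (fun s hs => h0 s ?_) (fun s hs => by simp at hs)
  rw [uIoc_of_le ha] at hs
  exact le_abs.2 (Or.inr (by linarith [hs.2]))

theorem integral_eq_of_one_le (hf : Continuous f) (h0 : ∀ t, 1 ≤ |t| → f t = 0)
    {a b : ℝ} (hb : 1 ≤ b) : ∫ u in a..b, f u = ∫ u in a..1, f u := by
  refine integral_eq_of_vanish hf (fun s hs => by simp at hs) (fun s hs => h0 s ?_)
  rw [uIoc_of_ge hb] at hs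
  exact le_abs.2 (Or.inl hs.1.le)

theorem window_of_nonpos (hf : Continuous f) (h0 : ∀ t, 1 ≤ |t| → f t = 0) {t : ℝ}
    (ht : t ≤ 0) : window f t = ∫ u in (-1)..(2 * t + 1), f u :=
  integral_eq_of_le_neg_one hf h0 (by linarith)

theorem window_of_nonneg (hf : Continuous f) (h0 : ∀ t, 1 ≤ |t| → f t = 0) {t : ℝ}
    (ht : 0 ≤ t) : window f t = ∫ u in (2 * t - 1)..1, f u :=
  integral_eq_of_one_le hf h0 (by linarith)

theorem window_eq_zero (h0 : ∀ t, 1 ≤ |t| → f t = 0) {t : ℝ} (ht : 1 ≤ |t|) :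
    window f t = 0 := by
  refine integral_eq_zero_of_vanish fun s hs => h0 s ?_
  rw [uIoc_of_le (by linarith)] at hs
  rcases le_abs.1 ht with h | h
  · exact le_abs.2 (Or.inl (by linarith [hs.1]))
  · exact le_abs.2 (Or.inr (by linarith [hs.2]))

theorem window_add_window_sub_one (hf : Continuous f) (h0 : ∀ t, 1 ≤ |t| → f t = 0) {t : ℝ}
    (ht : t ∈ Icc (0 : ℝ) 1) : window f t + window f (t - 1) = ∫ u in (-1)..1, f u := by
  rw [window_of_nonneg hf h0 ht.1, window_of_nonpos hf h0 (by linarith [ht.2]),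
    show 2 * (t - 1) + 1 = 2 * t - 1 by ring, add_comm]
  exact integral_add_adjacent_intervals (hf.intervalIntegrable _ _) (hf.intervalIntegrable _ _)

theorem integral_eq_of_translates (hf : Continuous f) {c : ℝ}
    (h : ∀ t ∈ Icc (0 : ℝ) 1, f t + f (t - 1) = c) : ∫ u in (-1)..1, f u = c := by
  have h1 : ∫ u in (-1)..0, f u = ∫ u in (0 : ℝ)..1, f (u - 1) := by
    rw [integral_comp_sub_right (fun u => f u) 1]
    norm_num
  have h2 : Continuous fun u : ℝ => f (u - 1) := by fun_prop
  rw [← integral_add_adjacent_intervals (hf.intervalIntegrable (-1) 0)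
    (hf.intervalIntegrable 0 1), h1, ← integral_add (h2.intervalIntegrable _ _)
    (hf.intervalIntegrable _ _), integral_congr (g := fun _ => c)]
  · simp
  · intro u hu
    rw [uIcc_of_le zero_le_one] at hu
    simp only
    rw [add_comm]
    exact h u hu

/-- First averaging of a difference: on `[-1, 1]` the bound improves to a multiple of
`|t| (1 - |t|)`. -/
theorem abs_window_le_of_le (hf : Continuous f) (h0 : ∀ t, 1 ≤ |t| → f t = 0)
    (hint : ∫ u in (-1)..1, f u = 0) {M : ℝ} (hM : ∀ t, |f t| ≤ M) {t : ℝ} (ht : |t| ≤ 1) :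
    |window f t| ≤ M * (4 * |t| * (1 - |t|)) := by
  have hM0 : 0 ≤ M := (abs_nonneg _).trans (hM 0)
  have key : ∀ a b : ℝ, a ≤ b → |∫ s in a..b, f s| ≤ M * (b - a) := fun a b hab => by
    have := norm_integral_le_of_norm_le_const (a := a) (b := b) (f := f) (C := M)
      (fun x _ => hM x)
    rwa [abs_of_nonneg (sub_nonneg.2 hab)] at this
  have hadd : ∀ u : ℝ, (∫ s in (-1)..u, f s) + ∫ s in u..1, f s = 0 := fun u => by
    rw [integral_add_adjacent_intervals (hf.intervalIntegrable _ _)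
      (hf.intervalIntegrable _ _), hint]
  -- The shorter of the two sides has length `min (2x) (2(1-x)) ≤ 4x(1-x)`; this smooth majorant is
  -- easier to integrate and still leaves a factor below `1`.
  have hmin : ∀ x v : ℝ, 0 ≤ x → x ≤ 1 → v ≤ M * (2 * x) → v ≤ M * (2 * (1 - x)) →
      v ≤ M * (4 * x * (1 - x)) := by
    intro x v hx hx1 h1 h2
    rcases le_total x (1 / 2) with h | h
    · exact h1.trans (mul_le_mul_of_nonneg_left (by nlinarith) hM0)
    · exact h2.trans (mul_le_mul_of_nonneg_left (by nlinarith) hM0)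
  obtain ⟨ht1, ht2⟩ := abs_le.1 ht
  rcases le_total t 0 with h | h
  · rw [window_of_nonpos hf h0 h, abs_of_nonpos h]
    have h1 := key (-1) (2 * t + 1) (by linarith)
    have h2 := key (2 * t + 1) 1 (by linarith)
    have h3 : ∫ s in (2 * t + 1)..1, f s = -∫ s in (-1)..(2 * t + 1), f s := by
      linarith [hadd (2 * t + 1)]
    rw [h3, abs_neg] at h2
    refine hmin _ _ (by linarith) (by linarith) ?_ ?_
    · convert h2 using 2; ring
    · convert h1 using 2; ring
  · rw [window_of_nonneg hf h0 h, abs_of_nonneg h]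
    have h1 := key (-1) (2 * t - 1) (by linarith)
    have h2 := key (2 * t - 1) 1 (by linarith)
    have h3 : ∫ s in (-1)..(2 * t - 1), f s = -∫ s in (2 * t - 1)..1, f s := by
      linarith [hadd (2 * t - 1)]
    rw [h3, abs_neg] at h1
    refine hmin _ _ (by linarith) (by linarith) ?_ ?_
    · convert h1 using 2; ring
    · convert h2 using 2; ring

/-- Second averaging: integrating the parabolic bound over `[-1, 0]` or `[0, 1]`, whichever half
contains the shorter side, gains the factor `2 / 3`. -/
theorem abs_window_le_two_thirds (hf : Continuous f) (h0 : ∀ t, 1 ≤ |t| → f t = 0)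
    (hint : ∫ u in (-1)..1, f u = 0) {M : ℝ}
    (hM : ∀ t, |t| ≤ 1 → |f t| ≤ M * (4 * |t| * (1 - |t|))) (t : ℝ) :
    |window f t| ≤ 2 / 3 * M := by
  have hpar : ∫ s in (0 : ℝ)..1, M * (4 * s * (1 - s)) = 2 / 3 * M := by
    have : ∀ s : ℝ, M * (4 * s * (1 - s)) = 4 * M * s - 4 * M * s ^ 2 := fun s => by ring
    simp only [this]
    rw [integral_sub (Continuous.intervalIntegrable (by fun_prop) _ _)
      (Continuous.intervalIntegrable (by fun_prop) _ _), integral_const_mul, integral_const_mul,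
      integral_id, integral_pow]
    ring
  have hM0 : 0 ≤ M := by
    have := (abs_nonneg _).trans (hM (1 / 2) (by norm_num [abs_of_pos]))
    rw [abs_of_pos (by norm_num)] at this
    linarith
  have hcont : Continuous fun s => |f s| := hf.abs
  -- The integral of `|f|` over a subinterval of `[0, 1]`.
  have hright : ∀ a, 0 ≤ a → a ≤ 1 → |∫ s in a..1, f s| ≤ 2 / 3 * M := by
    intro a ha ha1
    refine (abs_integral_le_integral_abs ha1).trans ?_
    have h1 : ∫ s in a..1, |f s| ≤ ∫ s in (0 : ℝ)..1, |f s| :=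
      integral_mono_interval ha ha1 le_rfl (Filter.Eventually.of_forall fun s => abs_nonneg _)
        (hcont.intervalIntegrable _ _)
    refine h1.trans ?_
    rw [← hpar]
    refine integral_mono_on zero_le_one (hcont.intervalIntegrable _ _)
      (Continuous.intervalIntegrable (by fun_prop) _ _) fun s hs => ?_
    simpa [abs_of_nonneg hs.1] using hM s (by rw [abs_of_nonneg hs.1]; exact hs.2)
  have hleft : ∀ a, -1 ≤ a → a ≤ 0 → |∫ s in (-1)..a, f s| ≤ 2 / 3 * M := by
    intro a ha ha1
    refine (abs_integral_le_integral_abs ha).trans ?_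
    have h1 : ∫ s in (-1)..a, |f s| ≤ ∫ s in (-1 : ℝ)..0, |f s| :=
      integral_mono_interval le_rfl ha ha1 (Filter.Eventually.of_forall fun s => abs_nonneg _)
        (hcont.intervalIntegrable _ _)
    refine h1.trans ?_
    have h2 : ∫ s in (-1 : ℝ)..0, |f s| = ∫ s in (0 : ℝ)..1, |f (-s)| := by
      rw [integral_comp_neg (fun s => |f s|)]
      simp
    have hc' : Continuous fun s => |f (-s)| := by fun_prop
    rw [← hpar, h2]
    refine integral_mono_on zero_le_one (hc'.intervalIntegrable _ _)
      (Continuous.intervalIntegrable (by fun_prop) _ _) fun s hs => ?_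
    simpa [abs_of_nonneg hs.1] using hM (-s) (by rw [abs_neg, abs_of_nonneg hs.1]; exact hs.2)
  have hadd : ∀ u : ℝ, (∫ s in (-1)..u, f s) + ∫ s in u..1, f s = 0 := fun u => by
    rw [integral_add_adjacent_intervals (hf.intervalIntegrable _ _)
      (hf.intervalIntegrable _ _), hint]
  have hP : ∀ u, -1 ≤ u → u ≤ 1 → |∫ s in (-1)..u, f s| ≤ 2 / 3 * M := by
    intro u hu hu1
    rcases le_total u 0 with h | h
    · exact hleft u hu h
    · rw [eq_neg_of_add_eq_zero_left (hadd u), abs_neg]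
      exact hright u h hu1
  rcases le_or_gt 1 |t| with h | h
  · rw [window_eq_zero h0 h, abs_zero]
    positivity
  obtain ⟨ht1, ht2⟩ := abs_lt.1 h
  rcases le_total t 0 with h | h
  · rw [window_of_nonpos hf h0 h]
    exact hP _ (by linarith) (by linarith)
  · rw [window_of_nonneg hf h0 h, eq_neg_of_add_eq_zero_right (hadd _), abs_neg]
    exact hP _ (by linarith) (by linarith)

end Vanishing

/-! ### Existence and uniqueness of the fixed point -/

/-- A nonnegative continuous function vanishing outside `(-1, 1)` whose integer translates form a
partition of unity; it is enough to ask `f t + f (t - 1) = 1` on `[0, 1]`, as the other translates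
vanish there. -/
structure IsPartitionBump (f : ℝ → ℝ) : Prop where
  continuous : Continuous f
  nonneg : ∀ t, 0 ≤ f t
  eq_zero : ∀ t, 1 ≤ |t| → f t = 0
  add_eq_one : ∀ t ∈ Icc (0 : ℝ) 1, f t + f (t - 1) = 1

namespace IsPartitionBump

variable {f g : ℝ → ℝ}

theorem le_one (hf : IsPartitionBump f) (t : ℝ) : f t ≤ 1 := by
  rcases le_or_gt 1 |t| with h | h
  · rw [hf.eq_zero t h]
    exact zero_le_one
  obtain ⟨h1, h2⟩ := abs_lt.1 h
  rcases le_total 0 t with h0 | h0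
  · linarith [hf.add_eq_one t ⟨h0, h2.le⟩, hf.nonneg (t - 1)]
  · have := hf.add_eq_one (t + 1) ⟨by linarith, by linarith⟩
    rw [add_sub_cancel_right] at this
    linarith [hf.nonneg (t + 1)]

theorem map_zero (hf : IsPartitionBump f) : f 0 = 1 := by
  have := hf.add_eq_one 0 ⟨le_rfl, zero_le_one⟩
  rwa [hf.eq_zero (0 - 1) (by norm_num), add_zero] at this

theorem integral_eq_one (hf : IsPartitionBump f) : ∫ u in (-1)..1, f u = 1 :=
  integral_eq_of_translates hf.continuous hf.add_eq_one

protected theorem window (hf : IsPartitionBump f) : IsPartitionBump (window f) where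
  continuous := continuous_window hf.continuous
  nonneg t := integral_nonneg (by linarith) fun u _ => hf.nonneg u
  eq_zero _ ht := window_eq_zero hf.eq_zero ht
  add_eq_one t ht := by
    rw [window_add_window_sub_one hf.continuous hf.eq_zero ht, hf.integral_eq_one]

theorem tent : IsPartitionBump fun t => max 0 (1 - |t|) where
  continuous := by fun_prop
  nonneg t := le_max_left _ _
  eq_zero t ht := max_eq_left (by linarith)
  add_eq_one t ht := by
    have h1 : |t| = t := abs_of_nonneg ht.1
    have h2 : |t - 1| = 1 - t := by rw [abs_sub_comm, abs_of_nonneg (by linarith [ht.2])]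
    simp only [h1, h2]
    rw [max_eq_right (by linarith [ht.2]), max_eq_right (by linarith [ht.1])]
    ring

theorem window_sub (hf : IsPartitionBump f) (hg : IsPartitionBump g) :
    window (fun t => f t - g t) = fun t => window f t - window g t := by
  funext t
  exact integral_sub (hf.continuous.intervalIntegrable _ _) (hg.continuous.intervalIntegrable _ _)

/-- Averaging twice contracts the uniform distance by the factor `2 / 3`. -/
theorem abs_window_window_sub_le (hf : IsPartitionBump f) (hg : IsPartitionBump g) {M : ℝ}
    (hM : ∀ t, |f t - g t| ≤ M) (t : ℝ) :
    |window (window f) t - window (window g) t| ≤ 2 / 3 * M := by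
  have hc : Continuous fun t => f t - g t := hf.continuous.sub hg.continuous
  have h0 : ∀ t, 1 ≤ |t| → f t - g t = 0 := fun t ht => by
    rw [hf.eq_zero t ht, hg.eq_zero t ht, sub_zero]
  have hint : ∫ u in (-1)..1, (f u - g u) = 0 :=
    integral_eq_of_translates hc fun t ht => by
      linarith [hf.add_eq_one t ht, hg.add_eq_one t ht]
  have h0' : ∀ t, 1 ≤ |t| → window (fun t => f t - g t) t = 0 := fun t ht => window_eq_zero h0 ht
  have hint' : ∫ u in (-1)..1, window (fun t => f t - g t) u = 0 :=
    integral_eq_of_translates (continuous_window hc) fun t ht => by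
      rw [window_add_window_sub_one hc h0 ht, hint]
  have := abs_window_le_two_thirds (continuous_window hc) h0' hint'
    (fun t ht => abs_window_le_of_le hc h0 hint hM ht) t
  rwa [window_sub hf hg, window_sub hf.window hg.window] at this

/-- A partition bump as a bounded continuous function. -/
def toBounded (hf : IsPartitionBump f) : BoundedContinuousFunction ℝ ℝ :=
  BoundedContinuousFunction.ofNormedAddCommGroup f hf.continuous 1 fun t => by
    rw [Real.norm_eq_abs, abs_of_nonneg (hf.nonneg t)]
    exact hf.le_one t

theorem isClosed_setOf : IsClosed {f : BoundedContinuousFunction ℝ ℝ | IsPartitionBump f} := by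
  have heq : {f : BoundedContinuousFunction ℝ ℝ | IsPartitionBump f} =
      {f | ∀ t, 0 ≤ f t} ∩ ({f | ∀ t, 1 ≤ |t| → f t = 0} ∩
        {f | ∀ t ∈ Icc (0 : ℝ) 1, f t + f (t - 1) = 1}) := by
    ext f
    exact ⟨fun h => ⟨h.nonneg, h.eq_zero, h.add_eq_one⟩, fun h => ⟨f.continuous, h.1, h.2.1, h.2.2⟩⟩
  have hev : ∀ t : ℝ, Continuous fun f : BoundedContinuousFunction ℝ ℝ => f t := fun t =>
    continuous_eval_const t
  rw [heq]
  refine IsClosed.inter ?_ (IsClosed.inter ?_ ?_)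
  · simp only [ofPred_forall]
    exact isClosed_iInter fun t => isClosed_le continuous_const (hev t)
  · simp only [ofPred_forall]
    exact isClosed_iInter fun t => isClosed_iInter fun _ => isClosed_eq (hev t) continuous_const
  · simp only [ofPred_forall]
    exact isClosed_iInter fun t => isClosed_iInter fun _ =>
      isClosed_eq ((hev t).add (hev _)) continuous_const

/-- The averaging operator on the complete metric space of partition bumps. -/
noncomputable def step (f : {f : BoundedContinuousFunction ℝ ℝ // IsPartitionBump f}) :
    {f : BoundedContinuousFunction ℝ ℝ // IsPartitionBump f} :=
  ⟨f.2.window.toBounded, f.2.window⟩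

theorem contracting_step : ContractingWith (2 / 3) (step^[2]) := by
  refine ⟨by norm_num, LipschitzWith.of_dist_le_mul fun f g => ?_⟩
  rw [Subtype.dist_eq, Subtype.dist_eq,
    BoundedContinuousFunction.dist_le (mul_nonneg (NNReal.coe_nonneg _) dist_nonneg)]
  intro t
  have h := abs_window_window_sub_le f.2 g.2 (M := dist f.1 g.1)
    (fun t => (f.1.dist_coe_le_dist (g := g.1) t)) t
  push_cast
  exact h

/-- Two partition bumps fixed by averaging coincide. -/
theorem eq_of_window_eq (hf : IsPartitionBump f) (hg : IsPartitionBump g) (hff : window f = f)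
    (hgg : window g = g) : f = g := by
  have key : ∀ {e : ℝ → ℝ} (he : IsPartitionBump e), window e = e →
      Function.IsFixedPt (step^[2]) ⟨he.toBounded, he⟩ := by
    intro e he hee
    refine Function.IsFixedPt.iterate ?_ 2
    exact Subtype.ext (DFunLike.coe_injective hee)
  have h := contracting_step.fixedPoint_unique' (key hf hff) (key hg hgg)
  have h1 : hf.toBounded = hg.toBounded := congrArg Subtype.val h
  exact congrArg (fun e : BoundedContinuousFunction ℝ ℝ => (e : ℝ → ℝ)) h1

theorem exists_window_eq : ∃ f, IsPartitionBump f ∧ window f = f := by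
  have : CompleteSpace {f : BoundedContinuousFunction ℝ ℝ // IsPartitionBump f} :=
    isClosed_setOf.completeSpace_coe
  have : Nonempty {f : BoundedContinuousFunction ℝ ℝ // IsPartitionBump f} :=
    ⟨⟨tent.toBounded, tent⟩⟩
  have h := contracting_step.isFixedPt_fixedPoint_iterate
  refine ⟨_, (ContractingWith.fixedPoint _ contracting_step).2, ?_⟩
  exact congrArg (fun e : {f : BoundedContinuousFunction ℝ ℝ // IsPartitionBump f} =>
    (e.1 : ℝ → ℝ)) h

/-! ### Smoothness and positivity of the fixed point -/

section Fixed

variable (hf : IsPartitionBump f) (hw : window f = f)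
include hf hw

theorem hasDerivAt (t : ℝ) : HasDerivAt f (2 * (f (2 * t + 1) - f (2 * t - 1))) t := by
  have := hasDerivAt_window hf.continuous t
  rwa [hw] at this

theorem contDiff : ContDiff ℝ ∞ f := by
  refine contDiff_infty.2 fun n => ?_
  induction n with
  | zero => exact contDiff_zero.2 hf.continuous
  | succ n ih =>
    push_cast
    refine contDiff_succ_iff_deriv.2
      ⟨fun t => (hf.hasDerivAt hw t).differentiableAt, by simp, ?_⟩
    rw [show deriv f = fun t => 2 * (f (2 * t + 1) - f (2 * t - 1)) from
      funext fun t => (hf.hasDerivAt hw t).deriv]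
    have h1 : ContDiff ℝ n fun t : ℝ => f (2 * t + 1) := ih.comp (by fun_prop)
    have h2 : ContDiff ℝ n fun t : ℝ => f (2 * t - 1) := ih.comp (by fun_prop)
    exact contDiff_const.mul (h1.sub h2)

/-- Positivity spreads from `0`: if `f` is positive at a point of the window `[2t-1, 2t+1]`, then
`f t` is positive, and each such step halves the distance to the ends of `[-1, 1]`. -/
theorem pos_of_abs_le (n : ℕ) : ∀ t : ℝ, |t| ≤ 1 - 1 / 2 ^ n → 0 < f t := by
  induction n with
  | zero =>
    intro t ht
    have : t = 0 := abs_nonpos_iff.1 (by simpa using ht)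
    rw [this, hf.map_zero]
    exact zero_lt_one
  | succ n ih =>
    intro t ht
    have hn : (0 : ℝ) < 1 / 2 ^ n := by positivity
    have hn1 : (1 : ℝ) / 2 ^ n ≤ 1 := by
      rw [div_le_one (by positivity)]
      exact one_le_pow₀ (by norm_num)
    have hn2 : (1 : ℝ) / 2 ^ (n + 1) = 1 / 2 ^ n / 2 := by
      rw [pow_succ]
      field_simp
    rw [hn2] at ht
    obtain ⟨h1, h2⟩ := abs_le.1 ht
    -- A point of the window at which `f` is known to be positive.
    obtain ⟨c, hc, hcpos⟩ : ∃ c ∈ Icc (2 * t - 1) (2 * t + 1), 0 < f c := by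
      rcases le_total t 0 with h | h
      · refine ⟨-(1 - 1 / 2 ^ n), ⟨by linarith, by linarith⟩, ih _ ?_⟩
        rw [abs_neg, abs_of_nonneg (by linarith)]
      · refine ⟨1 - 1 / 2 ^ n, ⟨by linarith, by linarith⟩, ih _ ?_⟩
        rw [abs_of_nonneg (by linarith)]
    rw [← hw]
    exact integral_pos (by linarith) hf.continuous.continuousOn (fun x _ => hf.nonneg x)
      ⟨c, hc, hcpos⟩

theorem pos (t : ℝ) (ht : |t| < 1) : 0 < f t := by
  obtain ⟨n, hn⟩ := exists_pow_lt_of_lt_one (sub_pos.2 ht) (show (1 / 2 : ℝ) < 1 by norm_num)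
  refine hf.pos_of_abs_le hw n t ?_
  rw [div_pow, one_pow] at hn
  linarith

theorem isUp : IsUp f where
  smooth := hf.contDiff hw
  support_eq := by
    have : Function.support f = Ioo (-1) 1 := by
      ext t
      rw [Function.mem_support, mem_Ioo, ← abs_lt]
      refine ⟨fun h => ?_, fun h => (hf.pos hw t h).ne'⟩
      by_contra h'
      exact h (hf.eq_zero t (not_lt.1 h'))
    rw [tsupport, this, closure_Ioo (by norm_num)]
  pos t ht := hf.pos hw t (abs_lt.2 ht)
  map_zero := hf.map_zero
  deriv_eq := ⟨2, two_pos, fun t => (hf.hasDerivAt hw t).deriv⟩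

end Fixed

end IsPartitionBump

/-! ### Functions with the defining properties are fixed points -/

namespace IsUp

variable {φ : ℝ → ℝ} (h : IsUp φ)
include h

theorem eq_zero (t : ℝ) (ht : 1 ≤ |t|) : φ t = 0 := by
  by_contra hne
  -- `φ` would be nonzero near `t`, but it vanishes outside `[-1, 1]`.
  have hsub : Function.support φ ⊆ interior (Icc (-1) 1) :=
    interior_maximal (h.support_eq ▸ subset_tsupport φ)
      (h.smooth.continuous.isOpen_support)
  rw [interior_Icc] at hsub
  exact absurd (abs_lt.2 (hsub hne)) (not_lt.2 ht)

theorem nonneg (t : ℝ) : 0 ≤ φ t := by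
  rcases le_or_gt 1 |t| with ht | ht
  · exact (h.eq_zero t ht).ge
  · exact (h.pos t (abs_lt.1 ht)).le

/-- Integrating the functional equation, with both sides vanishing at `-1`. -/
theorem eq_mul_window {k : ℝ} (hk : ∀ t, deriv φ t = k * (φ (2 * t + 1) - φ (2 * t - 1))) (t : ℝ) :
    φ t = k / 2 * window φ t := by
  have hd : ∀ t, HasDerivAt (fun t => φ t - k / 2 * window φ t) 0 t := fun t => by
    have h1 : HasDerivAt φ (deriv φ t) t :=
      (h.smooth.differentiable (by simp) t).hasDerivAt
    refine (h1.sub ((hasDerivAt_window h.smooth.continuous t).const_mul (k / 2))).congr_deriv ?_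
    rw [hk]
    ring
  have := is_const_of_deriv_eq_zero (fun t => (hd t).differentiableAt) (fun t => (hd t).deriv)
    t (-1)
  rw [h.eq_zero (-1) (by norm_num), window_eq_zero h.eq_zero (t := -1) (by norm_num)] at this
  linarith

/-- The constant in the functional equation is forced to be `2`: with `I = ∫ φ`, the value at `0`
gives `k / 2 * I = 1`, so that `φ t + φ (t - 1) = 1` on `[0, 1]` and `I = 1`. -/
theorem isPartitionBump_and_window_eq : IsPartitionBump φ ∧ window φ = φ := by
  obtain ⟨k, -, hk⟩ := h.deriv_eq
  have hc := h.smooth.continuous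
  have hI : k / 2 * ∫ u in (-1)..1, φ u = 1 := by
    have := h.eq_mul_window hk 0
    rw [h.map_zero, window_of_nonneg hc h.eq_zero le_rfl] at this
    norm_num at this
    exact this.symm
  have hadd : ∀ t ∈ Icc (0 : ℝ) 1, φ t + φ (t - 1) = 1 := fun t ht => by
    rw [h.eq_mul_window hk t, h.eq_mul_window hk (t - 1), ← mul_add,
      window_add_window_sub_one hc h.eq_zero ht, hI]
  have hk2 : k / 2 = 1 := by
    rwa [integral_eq_of_translates hc hadd, mul_one] at hI
  refine ⟨⟨hc, h.nonneg, h.eq_zero, hadd⟩, funext fun t => ?_⟩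
  rw [h.eq_mul_window hk t, hk2, one_mul]

theorem isPartitionBump : IsPartitionBump φ := h.isPartitionBump_and_window_eq.1

theorem window_eq : window φ = φ := h.isPartitionBump_and_window_eq.2

theorem hasDerivAt (t : ℝ) : HasDerivAt φ (2 * (φ (2 * t + 1) - φ (2 * t - 1))) t :=
  h.isPartitionBump.hasDerivAt h.window_eq t

theorem eq_of_isUp {ψ : ℝ → ℝ} (hψ : IsUp ψ) : ψ = φ :=
  hψ.isPartitionBump.eq_of_window_eq h.isPartitionBump hψ.window_eq h.window_eq

/-- The reflection of `φ` has the defining properties, so it is `φ`. -/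
theorem map_neg (t : ℝ) : φ (-t) = φ t := by
  have hb := h.isPartitionBump
  have hb' : IsPartitionBump fun t => φ (-t) :=
    { continuous := hb.continuous.comp continuous_neg
      nonneg := fun t => hb.nonneg _
      eq_zero := fun t ht => hb.eq_zero _ (by rwa [abs_neg])
      add_eq_one := fun t ht => by
        have := hb.add_eq_one (1 - t) ⟨by linarith [ht.2], by linarith [ht.1]⟩
        rw [show 1 - t - 1 = -t by ring] at this
        rw [neg_sub, add_comm]
        exact this }
  have hw' : (window fun t => φ (-t)) = fun t => φ (-t) := by
    funext s
    have : (window fun t => φ (-t)) s = window φ (-s) := by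
      rw [window, window, integral_comp_neg (fun u => φ u)]
      congr 1 <;> ring
    rw [this, h.window_eq]
  exact congrFun (hb'.eq_of_window_eq hb hw' h.window_eq) t

end IsUp

theorem existsUnique_isUp : ∃! φ : ℝ → ℝ, IsUp φ := by
  obtain ⟨f, hf, hw⟩ := IsPartitionBump.exists_window_eq
  exact ⟨f, hf.isUp hw, fun ψ hψ => (hf.isUp hw).eq_of_isUp hψ⟩

/-! ### Binary digits and sums over even indices -/

theorem binaryDigitSum_two_mul (h : ℕ) : binaryDigitSum (2 * h) = binaryDigitSum h := by
  rcases Nat.eq_zero_or_pos h with rfl | hpos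
  · simp
  · rw [binaryDigitSum, Nat.digits_def' (by norm_num) (by omega)]
    simp [binaryDigitSum]

theorem binaryDigitSum_two_mul_add_one (h : ℕ) :
    binaryDigitSum (2 * h + 1) = binaryDigitSum h + 1 := by
  rw [binaryDigitSum, Nat.digits_def' (by norm_num) (by omega), List.sum_cons, binaryDigitSum,
    show (2 * h + 1) % 2 = 1 by omega, show (2 * h + 1) / 2 = h by omega, add_comm]

theorem sum_range_two_mul {M : Type*} [AddCommMonoid M] (f : ℕ → M) (m : ℕ) :
    ∑ j ∈ Finset.range (2 * m), f j = ∑ j ∈ Finset.range m, (f (2 * j) + f (2 * j + 1)) := by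
  induction m with
  | zero => simp
  | succ m ih =>
    rw [show 2 * (m + 1) = 2 * m + 1 + 1 by ring, Finset.sum_range_succ, Finset.sum_range_succ, ih,
      Finset.sum_range_succ, add_assoc]

theorem sum_range_succ_of_odd_eq_zero {M : Type*} [AddCommMonoid M] (f : ℕ → M)
    (hf : ∀ j, f (2 * j + 1) = 0) (n : ℕ) :
    ∑ j ∈ Finset.range (n + 1), f j = ∑ j ∈ Finset.range (n / 2 + 1), f (2 * j) := by
  rcases Nat.even_or_odd' n with ⟨m, rfl | rfl⟩
  · rw [Finset.sum_range_succ, sum_range_two_mul, Nat.mul_div_cancel_left _ two_pos,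
      Finset.sum_range_succ]
    simp [hf]
  · rw [show 2 * m + 1 + 1 = 2 * (m + 1) by ring, sum_range_two_mul,
      show (2 * m + 1) / 2 = m by omega]
    simp [hf]

/-! ### Repeated primitives -/

/-- The `(n+1)`-fold primitive of `φ` that vanishes at `-1`, by Cauchy's formula for repeated
integration. -/
noncomputable def iterPrimitive (φ : ℝ → ℝ) (n : ℕ) (x : ℝ) : ℝ :=
  ∫ u in (-1)..x, (x - u) ^ n / n.factorial * φ u

/-- The `n`-th moment of a function supported in `[-1, 1]`. -/
noncomputable def moment (φ : ℝ → ℝ) (n : ℕ) : ℝ := ∫ u in (-1)..1, u ^ n * φ u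

theorem integral_comp_two_mul_add {g : ℝ → ℝ} (a b d : ℝ) :
    2 * ∫ s in a..b, g (2 * s + d) = ∫ v in (2 * a + d)..(2 * b + d), g v := by
  rw [integral_comp_mul_add _ two_ne_zero, smul_eq_mul, mul_inv_cancel_left₀ two_ne_zero]

namespace IsUp

variable {φ : ℝ → ℝ} (h : IsUp φ)
include h

theorem continuous : Continuous φ := h.smooth.continuous

/-- Integrate by parts, replace the derivative of `φ` by the functional equation, and substitute in
each of the two resulting integrals. -/
theorem integral_deriv_mul {p p' : ℝ → ℝ} (hp : ∀ s, HasDerivAt p (p' s) s)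
    (hp' : Continuous p') {x : ℝ} (hx : p x * φ x = 0) :
    ∫ s in (-1)..x, p' s * φ s =
      (∫ v in (-1)..(2 * x - 1), p ((v + 1) / 2) * φ v) -
        ∫ v in (-1)..(2 * x + 1), p ((v - 1) / 2) * φ v := by
  have hc := h.continuous
  have hpc : Continuous p := continuous_iff_continuousAt.2 fun s => (hp s).continuousAt
  have hd : Continuous fun s => 2 * (φ (2 * s + 1) - φ (2 * s - 1)) := by fun_prop
  have hparts := integral_mul_deriv_eq_deriv_mul (a := -1) (b := x) (u := p) (v := φ)
    (u' := p') (v' := fun s => 2 * (φ (2 * s + 1) - φ (2 * s - 1)))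
    (fun s _ => hp s) (fun s _ => h.hasDerivAt s) (hp'.intervalIntegrable _ _)
    (hd.intervalIntegrable _ _)
  rw [hx, h.eq_zero (-1) (by norm_num), mul_zero, sub_zero, zero_sub] at hparts
  have hplus := integral_comp_two_mul_add (g := fun v => p ((v - 1) / 2) * φ v) (-1) x 1
  have hminus := integral_comp_two_mul_add (g := fun v => p ((v + 1) / 2) * φ v) (-1) x (-1)
  rw [show (2 : ℝ) * -1 + 1 = -1 by norm_num] at hplus
  -- The second window starts at `-3`, outside the support.
  rw [integral_eq_of_le_neg_one (f := fun v => p ((v + 1) / 2) * φ v) (by fun_prop)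
    (fun t ht => by rw [h.eq_zero t ht, mul_zero]) (by norm_num)] at hminus
  rw [show 2 * x - 1 = 2 * x + -1 by ring, ← hplus, ← hminus, ← mul_sub,
    ← integral_sub (Continuous.intervalIntegrable (by fun_prop) _ _)
      (Continuous.intervalIntegrable (by fun_prop) _ _), ← neg_eq_iff_eq_neg.2 hparts,
    ← integral_const_mul, ← integral_neg]
  refine integral_congr fun s _ => ?_
  rw [show (2 * s + 1 - 1) / 2 = s by ring, show (2 * s + -1 + 1) / 2 = s by ring,
    show 2 * s + -1 = 2 * s - 1 by ring]
  ring

theorem iterPrimitive_eq_zero (n : ℕ) {x : ℝ} (hx : x ≤ -1) : iterPrimitive φ n x = 0 := by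
  refine integral_eq_zero_of_vanish fun s hs => ?_
  rw [uIoc_of_ge hx] at hs
  rw [h.eq_zero s (le_abs.2 (Or.inr (by linarith [hs.2]))), mul_zero]

theorem iterPrimitive_recurrence (n : ℕ) (x : ℝ) :
    iterPrimitive φ n x = 1 / 2 ^ (n + 1) *
      (iterPrimitive φ (n + 1) (2 * x + 1) - iterPrimitive φ (n + 1) (2 * x - 1)) := by
  have hp : ∀ s : ℝ, HasDerivAt (fun s => -((x - s) ^ (n + 1) / (n + 1).factorial))
      ((x - s) ^ n / n.factorial) s := fun s => by
    have := ((((hasDerivAt_id s).const_sub x).pow (n + 1)).div_const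
      ((n + 1).factorial : ℝ)).neg
    refine this.congr_deriv ?_
    rw [Nat.factorial_succ]
    push_cast
    simp
    field_simp
  have hplus : ∫ v in (-1)..(2 * x + 1), -((x - (v - 1) / 2) ^ (n + 1) / (n + 1).factorial) * φ v =
      -(1 / 2 ^ (n + 1) * iterPrimitive φ (n + 1) (2 * x + 1)) := by
    rw [iterPrimitive, ← integral_const_mul, ← integral_neg]
    refine integral_congr fun v _ => ?_
    rw [show 2 * x + 1 - v = (x - (v - 1) / 2) * 2 by ring, mul_pow]
    field_simp
  have hminus : ∫ v in (-1)..(2 * x - 1),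
      -((x - (v + 1) / 2) ^ (n + 1) / (n + 1).factorial) * φ v =
      -(1 / 2 ^ (n + 1) * iterPrimitive φ (n + 1) (2 * x - 1)) := by
    rw [iterPrimitive, ← integral_const_mul, ← integral_neg]
    refine integral_congr fun v _ => ?_
    rw [show 2 * x - 1 - v = (x - (v + 1) / 2) * 2 by ring, mul_pow]
    field_simp
  rw [iterPrimitive, h.integral_deriv_mul hp (by fun_prop) (by simp), hplus, hminus]
  ring

/-- Iterating the functional equation `n+1` times; the sign of the term `h` is given by the parity
of its binary digits, since the recurrence sends `h` to `2h` and, with a minus sign, to `2h+1`. -/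
theorem eq_sum_iterPrimitive (n : ℕ) (t : ℝ) :
    φ t = 1 / 2 ^ (n + 1).choose 2 * ∑ j ∈ Finset.range (2 ^ (n + 1)),
      (-1) ^ binaryDigitSum j *
        iterPrimitive φ n (2 ^ (n + 1) * t + 2 ^ (n + 1) - 1 - 2 * j) := by
  induction n with
  | zero =>
    have h1 : φ t = window φ t := by rw [h.window_eq]
    rw [h1, window_eq_sub h.continuous (-1)]
    have h2 : binaryDigitSum 1 = 1 := by simp [binaryDigitSum]
    have h3 : binaryDigitSum 0 = 0 := by simp [binaryDigitSum]
    rw [zero_add, pow_one, Finset.sum_range_succ, Finset.sum_range_one]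
    simp only [iterPrimitive, h2, h3]
    norm_num
    ring_nf
  | succ n ih =>
    rw [ih, pow_succ' 2 (n + 1), sum_range_two_mul, Nat.choose_succ_succ' (n + 1) 1,
      Nat.choose_one_right, pow_add, Finset.mul_sum, Finset.mul_sum]
    refine Finset.sum_congr rfl fun j _ => ?_
    rw [binaryDigitSum_two_mul, binaryDigitSum_two_mul_add_one, h.iterPrimitive_recurrence]
    push_cast
    rw [show 2 * ((2 : ℝ) ^ (n + 1) * t + 2 ^ (n + 1) - 1 - 2 * j) + 1 =
        2 ^ (n + 1 + 1) * t + 2 ^ (n + 1 + 1) - 1 - 2 * (2 * j) by ring,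
      show 2 * ((2 : ℝ) ^ (n + 1) * t + 2 ^ (n + 1) - 1 - 2 * j) - 1 =
        2 ^ (n + 1 + 1) * t + 2 ^ (n + 1 + 1) - 1 - 2 * (2 * j + 1) by ring]
    field_simp
    ring

/-! ### Moments -/

theorem moment_odd (k : ℕ) : moment φ (2 * k + 1) = 0 := by
  have h1 : moment φ (2 * k + 1) = -moment φ (2 * k + 1) := by
    have h2 := integral_comp_neg (a := -1) (b := 1) fun u : ℝ => u ^ (2 * k + 1) * φ u
    rw [neg_neg] at h2
    rw [moment, ← integral_neg, ← h2]
    refine integral_congr fun s _ => ?_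
    rw [h.map_neg, Odd.neg_pow ⟨k, rfl⟩, neg_mul]
  linarith

theorem integral_left_even (k : ℕ) :
    ∫ u in (-1)..0, u ^ (2 * k) * φ u = moment φ (2 * k) / 2 := by
  have hc := h.continuous
  have hc' : Continuous fun u => u ^ (2 * k) * φ u := by fun_prop
  have h1 : ∫ u in (-1)..0, u ^ (2 * k) * φ u = ∫ u in (0 : ℝ)..1, u ^ (2 * k) * φ u := by
    have h2 := integral_comp_neg (a := 0) (b := 1) fun u : ℝ => u ^ (2 * k) * φ u
    rw [neg_zero] at h2
    rw [← h2]
    refine integral_congr fun s _ => ?_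
    rw [h.map_neg, Even.neg_pow ⟨k, by ring⟩]
  have h2 := integral_add_adjacent_intervals (hc'.intervalIntegrable (μ := MeasureTheory.volume)
    (-1) 0) (hc'.intervalIntegrable 0 1)
  rw [moment, ← h2, ← h1]
  ring

/-- Only the first term of `eq_sum_iterPrimitive` survives at `2^{-2k-1} - 1`. -/
theorem value_eq_moment (k : ℕ) :
    φ (1 - 1 / 2 ^ (2 * k + 1)) =
      moment φ (2 * k) / (2 * ((2 * k).factorial : ℝ) * 2 ^ ((2 * k + 1).choose 2)) := by
  rw [← h.map_neg, h.eq_sum_iterPrimitive (2 * k), Finset.sum_eq_single_of_mem 0 (by simp)]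
  · have h1 : (2 : ℝ) ^ (2 * k + 1) * -(1 - 1 / 2 ^ (2 * k + 1)) + 2 ^ (2 * k + 1) - 1 -
        2 * (0 : ℕ) = 0 := by
      push_cast
      field_simp
      ring
    have h2 : iterPrimitive φ (2 * k) 0 = moment φ (2 * k) / 2 / (2 * k).factorial := by
      rw [← h.integral_left_even, iterPrimitive, ← integral_div]
      refine integral_congr fun s _ => ?_
      rw [zero_sub, Even.neg_pow ⟨k, by ring⟩]
      ring
    rw [h1, h2]
    simp [binaryDigitSum]
    ring
  · intro j _ hj
    rw [h.iterPrimitive_eq_zero, mul_zero]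
    have h1 : (2 : ℝ) ^ (2 * k + 1) * -(1 - 1 / 2 ^ (2 * k + 1)) + 2 ^ (2 * k + 1) - 1 - 2 * j =
        -2 * j := by
      field_simp
      ring
    have h2 : (1 : ℝ) ≤ j := by exact_mod_cast Nat.one_le_iff_ne_zero.2 hj
    rw [h1]
    linarith

theorem moment_recurrence (k : ℕ) :
    (2 * (k : ℝ) + 1) * 2 ^ (2 * k) * moment φ (2 * k) =
      ∑ j ∈ Finset.range (k + 1), ((2 * k + 1).choose (2 * j) : ℝ) * moment φ (2 * j) := by
  have hc := h.continuous
  have hp : ∀ s : ℝ, HasDerivAt (fun s => s ^ (2 * k + 1)) ((2 * (k : ℝ) + 1) * s ^ (2 * k)) s :=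
    fun s => by simpa using hasDerivAt_pow (2 * k + 1) s
  have h1 := h.integral_deriv_mul hp (by fun_prop) (x := 1)
    (by rw [h.eq_zero 1 (by norm_num), mul_zero])
  have h2 : ∀ v : ℝ, 2 ^ (2 * k) * (((v + 1) / 2) ^ (2 * k + 1) * φ v -
      ((v - 1) / 2) ^ (2 * k + 1) * φ v) =
      ∑ j ∈ Finset.range (k + 1), ((2 * k + 1).choose (2 * j) : ℝ) * (v ^ (2 * j) * φ v) := by
    intro v
    have hodd : ∀ i, ((2 * k + 1).choose (2 * i + 1) : ℝ) * v ^ (2 * i + 1) *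
        (1 - (-1) ^ (2 * k + 1 - (2 * i + 1))) = 0 := fun i => by
      rw [Even.neg_one_pow ⟨k - i, by omega⟩, sub_self, mul_zero]
    have hbin : (v + 1) ^ (2 * k + 1) - (v - 1) ^ (2 * k + 1) =
        ∑ j ∈ Finset.range (2 * k + 1 + 1),
          ((2 * k + 1).choose j : ℝ) * v ^ j * (1 - (-1) ^ (2 * k + 1 - j)) := by
      rw [sub_eq_add_neg v, add_pow, add_pow, ← Finset.sum_sub_distrib]
      refine Finset.sum_congr rfl fun j _ => ?_
      rw [one_pow]
      ring
    rw [sum_range_succ_of_odd_eq_zero _ hodd, show (2 * k + 1) / 2 = k by omega] at hbin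
    have hhalf : (2 : ℝ) ^ (2 * k) * (((v + 1) / 2) ^ (2 * k + 1) * φ v -
        ((v - 1) / 2) ^ (2 * k + 1) * φ v) =
        ((v + 1) ^ (2 * k + 1) - (v - 1) ^ (2 * k + 1)) / 2 * φ v := by
      rw [div_pow, div_pow, pow_succ 2]
      field_simp
    rw [hhalf, hbin, Finset.sum_div, Finset.sum_mul]
    refine Finset.sum_congr rfl fun j hj => ?_
    have hj' := Finset.mem_range.1 hj
    rw [Odd.neg_one_pow ⟨k - j, by omega⟩]
    ring
  have h3 : ∫ v in (-1)..(2 * 1 + 1), ((v - 1) / 2) ^ (2 * k + 1) * φ v =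
      ∫ v in (-1)..1, ((v - 1) / 2) ^ (2 * k + 1) * φ v :=
    integral_eq_of_one_le (by fun_prop) (fun t ht => by rw [h.eq_zero t ht, mul_zero])
      (by norm_num)
  have h4 : ∫ s in (-1)..1, (2 * (k : ℝ) + 1) * s ^ (2 * k) * φ s =
      (2 * (k : ℝ) + 1) * moment φ (2 * k) := by
    rw [moment, ← integral_const_mul]
    simp only [mul_assoc]
  rw [h3, h4, show (2 : ℝ) * 1 - 1 = 1 by norm_num,
    ← integral_sub (Continuous.intervalIntegrable (by fun_prop) _ _)
      (Continuous.intervalIntegrable (by fun_prop) _ _)] at h1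
  rw [mul_right_comm, h1, mul_comm, ← integral_const_mul]
  simp only [h2]
  rw [integral_finsetSum fun j _ => Continuous.intervalIntegrable (by fun_prop) _ _]
  simp only [integral_const_mul, moment]

theorem moment_zero : moment φ 0 = 1 := by
  simp [moment, h.isPartitionBump.integral_eq_one]

theorem moment_eq_upCoeff (k : ℕ) : moment φ (2 * k) = upCoeff k := by
  induction k using Nat.strong_induction_on with
  | _ k ih =>
    rcases Nat.eq_zero_or_pos k with rfl | hk
    · rw [mul_zero, h.moment_zero, upCoeff_zero, Rat.cast_one]
    have h1 := h.moment_recurrence k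
    have h2 : (2 * (k : ℝ) + 1) * 2 ^ (2 * k) * (upCoeff k : ℝ) =
        ∑ j ∈ Finset.range (k + 1), ((2 * k + 1).choose (2 * j) : ℝ) * (upCoeff j : ℝ) := by
      exact_mod_cast upCoeff_recurrence k
    have h3 : ∑ j ∈ Finset.range k, ((2 * k + 1).choose (2 * j) : ℝ) * moment φ (2 * j) =
        ∑ j ∈ Finset.range k, ((2 * k + 1).choose (2 * j) : ℝ) * (upCoeff j : ℝ) :=
      Finset.sum_congr rfl fun j hj => by rw [ih j (Finset.mem_range.1 hj)]
    rw [Finset.sum_range_succ, Nat.choose_succ_self_right] at h1 h2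
    push_cast at h1 h2
    rw [h3] at h1
    have h4 : (2 * (k : ℝ) + 1) * (2 ^ (2 * k) - 1) ≠ 0 := by
      have : (1 : ℝ) < 2 ^ (2 * k) := one_lt_pow₀ (by norm_num) (by omega)
      exact mul_ne_zero (by positivity) (by linarith)
    refine mul_left_cancel₀ h4 ?_
    linear_combination h1 - h2

/-! ### Dyadic values -/

theorem iterPrimitive_of_one_le (n : ℕ) {x : ℝ} (hx : 1 ≤ x) :
    iterPrimitive φ n x = ∑ k ∈ Finset.range (n / 2 + 1),
      x ^ (n - 2 * k) / ((n - 2 * k).factorial * (2 * k).factorial) * moment φ (2 * k) := by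
  have hc := h.continuous
  have hbin : ∀ u : ℝ, (x - u) ^ n / n.factorial * φ u = ∑ j ∈ Finset.range (n + 1),
      (-1) ^ j * (x ^ (n - j) / ((n - j).factorial * j.factorial)) * (u ^ j * φ u) := by
    intro u
    rw [sub_eq_neg_add, add_pow, Finset.sum_div, Finset.sum_mul]
    refine Finset.sum_congr rfl fun j hj => ?_
    rw [Nat.cast_choose ℝ (Nat.lt_succ_iff.1 (Finset.mem_range.1 hj)), neg_pow u]
    have h1 : (n.factorial : ℝ) ≠ 0 := by positivity
    field_simp
  rw [iterPrimitive, integral_eq_of_one_le (by fun_prop)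
    (fun t ht => by rw [h.eq_zero t ht, mul_zero]) hx]
  simp only [hbin]
  rw [integral_finsetSum fun j _ => Continuous.intervalIntegrable (by fun_prop) _ _]
  simp only [integral_const_mul]
  rw [sum_range_succ_of_odd_eq_zero]
  · refine Finset.sum_congr rfl fun k _ => ?_
    rw [Even.neg_one_pow ⟨k, by ring⟩, one_mul, moment]
  · intro j
    have := h.moment_odd j
    rw [moment] at this
    rw [this, mul_zero]

theorem dyadic_formula (q : ℤ) (n : ℕ) (hq : |q| < 2 ^ n) :
    φ ((q : ℝ) / 2 ^ n) =
      2 * ∑ h ∈ Finset.range (q + 2 ^ n).toNat, ∑ k ∈ Finset.range (n / 2 + 1),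
        (-1 : ℝ) ^ binaryDigitSum h *
          ((2 : ℝ) ^ (((2 * k + 1).choose 2 : ℤ) - ((n + 1).choose 2 : ℤ)) /
            ((n - 2 * k).factorial : ℝ)) *
          (2 * ((q : ℝ) - (h : ℝ)) + 2 ^ (n + 1) - 1) ^ (n - 2 * k) *
          φ (1 - 1 / 2 ^ (2 * k + 1)) := by
  have hq' : ((q + 2 ^ n).toNat : ℤ) = q + 2 ^ n :=
    Int.toNat_of_nonneg (by linarith [(abs_lt.1 hq).1])
  have hsub : Finset.range (q + 2 ^ n).toNat ⊆ Finset.range (2 ^ (n + 1)) := by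
    refine Finset.range_subset_range.2 ?_
    zify
    rw [hq', pow_succ]
    linarith [(abs_lt.1 hq).2]
  have harg : ∀ j : ℕ, (2 : ℝ) ^ (n + 1) * (q / 2 ^ n) + 2 ^ (n + 1) - 1 - 2 * j =
      2 * ((q : ℝ) - j) + 2 ^ (n + 1) - 1 := fun j => by
    rw [pow_succ]
    field_simp
    ring
  rw [h.eq_sum_iterPrimitive n, ← Finset.sum_subset hsub, Finset.mul_sum, Finset.mul_sum]
  · refine Finset.sum_congr rfl fun j hj => ?_
    have hj' : (j : ℝ) + 1 ≤ q + 2 ^ n := by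
      have : (j : ℤ) < q + 2 ^ n := by
        rw [← hq']
        exact_mod_cast Finset.mem_range.1 hj
      exact_mod_cast Int.add_one_le_of_lt this
    rw [harg, h.iterPrimitive_of_one_le n (by rw [pow_succ]; linarith), Finset.mul_sum,
      Finset.mul_sum, Finset.mul_sum]
    refine Finset.sum_congr rfl fun k _ => ?_
    rw [h.value_eq_moment, zpow_sub₀ two_ne_zero, zpow_natCast, zpow_natCast]
    field_simp
  · intro j _ hj
    have hj' : (q : ℝ) + 2 ^ n ≤ j := by
      have : q + 2 ^ n ≤ (j : ℤ) := by
        rw [← hq']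
        exact_mod_cast not_lt.1 fun hlt => hj (Finset.mem_range.2 hlt)
      exact_mod_cast this
    rw [harg, h.iterPrimitive_eq_zero n (by rw [pow_succ]; linarith), mul_zero]

theorem value_eq_upCoeff (k : ℕ) :
    φ (1 - 1 / 2 ^ (2 * k + 1)) =
      (upCoeff k : ℝ) / (2 * ((2 * k).factorial : ℝ) * 2 ^ ((2 * k + 1).choose 2)) := by
  rw [h.value_eq_moment, h.moment_eq_upCoeff]

theorem exists_rat_eq (q : ℤ) (n : ℕ) : ∃ r : ℚ, φ ((q : ℝ) / 2 ^ n) = (r : ℝ) := by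
  by_cases hq : |q| < 2 ^ n
  · rw [h.dyadic_formula q n hq]
    simp only [h.value_eq_upCoeff]
    refine ⟨2 * ∑ h ∈ Finset.range (q + 2 ^ n).toNat, ∑ k ∈ Finset.range (n / 2 + 1),
      (-1) ^ binaryDigitSum h *
        (2 ^ (((2 * k + 1).choose 2 : ℤ) - ((n + 1).choose 2 : ℤ)) / ((n - 2 * k).factorial : ℚ)) *
        (2 * ((q : ℚ) - h) + 2 ^ (n + 1) - 1) ^ (n - 2 * k) *
        (upCoeff k / (2 * ((2 * k).factorial : ℚ) * 2 ^ ((2 * k + 1).choose 2))), ?_⟩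
    push_cast
    rfl
  · refine ⟨0, ?_⟩
    rw [Rat.cast_zero]
    refine h.eq_zero _ ?_
    rw [abs_div, abs_of_pos (by positivity : (0 : ℝ) < 2 ^ n), le_div_iff₀ (by positivity), one_mul]
    exact_mod_cast not_lt.1 hq

end IsUp

theorem theorem7 :
    (∃! φ : ℝ → ℝ, IsUp φ) ∧
    ∀ φ : ℝ → ℝ, IsUp φ →
      (∀ (q : ℤ) (n : ℕ), ∃ r : ℚ, φ ((q : ℝ) / 2 ^ n) = (r : ℝ)) ∧
      (∀ (q : ℤ) (n : ℕ), |q| < 2 ^ n →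
        φ ((q : ℝ) / 2 ^ n) =
          2 * ∑ h ∈ Finset.range (q + 2 ^ n).toNat, ∑ k ∈ Finset.range (n / 2 + 1),
            (-1 : ℝ) ^ binaryDigitSum h *
              ((2 : ℝ) ^ (((2 * k + 1).choose 2 : ℤ) - ((n + 1).choose 2 : ℤ)) /
                ((n - 2 * k).factorial : ℝ)) *
              (2 * ((q : ℝ) - (h : ℝ)) + 2 ^ (n + 1) - 1) ^ (n - 2 * k) *
              φ (1 - 1 / 2 ^ (2 * k + 1))) ∧
      (∀ k : ℕ,
        φ (1 - 1 / 2 ^ (2 * k + 1)) =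
          (upCoeff k : ℝ) /
            (2 * ((2 * k).factorial : ℝ) * 2 ^ ((2 * k + 1).choose 2))) := by
  exact ⟨existsUnique_isUp, fun φ h => ⟨h.exists_rat_eq, h.dyadic_formula, h.value_eq_upCoeff⟩⟩
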